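/- **Non-uniqueness of Nash equilibria.** Let $n\ge 0$, $J\ge 1$, let $\|\cdot\|$ be an arbitrary norm on $\mathbb R^n$, $\langle\cdot,\cdot\rangle$ the standard inner product, and $\varepsilon\ge 0$. Let $(\hat x_j,\hat y_j)\in\mathcal Z=\mathbb R^n\times\{-1,+1\}$, $j=1,\dots,J$, be training samples and $\hat{\mathbb P}=\frac1J\sum_{j=1}^J\delta_{(\hat x_j,\hat y_j)}$. Let $\ell(\theta,(x,y))=\max\{0,1-y\langle\theta,x\rangle\}$ for $\theta\in\mathbb R^n$ be the hinge loss, and let $c((x_1,y_1),(x_2,y_2))=\|x_1-x_2\|$ if $y_1=y_2$ and $=+\infty$ otherwise. Let $d_c(\mathbb Q,\hat{\mathbb P})=\inf_\pi \mathbb E_\pi[c(Z,\hat Z)]$, where $\pi$ ranges over all joint distributions of $(Z,\hat Z)$ with marginals $\mathbb Q$ and $\hat{\mathbb P}$, and let $\mathbb B_\varepsilon(\hat{\mathbb P})$ be the set of all probability distributions $\mathbb Q$ on $\mathcal Z$ with $d_c(\mathbb Q,\hat{\mathbb P})\le\varepsilon$. A Nash equilibrium is a pair $(\theta^\star,\mathbb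 Q^\star)\in\mathbb R^n\times\mathbb B_\varepsilon(\hat{\mathbb P})$ with $$\mathbb E_{\mathbb Q}[\ell(\theta^\star,Z)]\le\mathbb E_{\mathbb Q^\star}[\ell(\theta^\star,Z)]\le\mathbb E_{\mathbb Q^\star}[\ell(\theta,Z)]\qquad\forall\,\theta\in\mathbb R^n,\ \mathbb Q\in\mathbb B_\varepsilon(\hat{\mathbb P}),$$ and $\mathbb Q^\star$ is a Nash strategy of nature if it is part of a Nash equilibrium. Let $\tilde q^\star$ solve $$\max_{\tilde q\in\mathbb R^J}\Big\{\sum_{j}\tilde q_j:\ \Big\|\sum_{j}\tilde q_j\hat y_j\hat x_j\Big\|\le\varepsilon,\ 0\le\tilde q_j\le\tfrac1J\ \forall j\Big\},$$ and put $\mathcal J_0=\{j:\tilde q^\star_j=0\}$, $\mathcal J_+=\{j:\tilde q^\star_j>0\}$, $\tilde\xi=-\sum_j\tilde q^\star_j\hat y_j\hat x_j$ and $A=\{\alpha\in\mathbb R_+^J:\sum_j\alpha_j=1,\ \alpha_j=0\ \forall j\in\mathcal J_0\}$. For $\alpha\in A$ let $$\mathbb Q^\star(\alpha)=\frac1J\sum_{j\in\mathcal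 J_0}\delta_{(\hat x_j,\hat y_j)}+\sum_{j\in\mathcal J_+}\Big(\frac1J-\tilde q^\star_j\Big)\delta_{(\hat x_j,\hat y_j)}+\sum_{j\in\mathcal J_+}\tilde q^\star_j\,\delta_{(\hat x_j+\alpha_j\hat y_j\tilde\xi/\tilde q^\star_j,\ \hat y_j)}.$$ 1. For every $\alpha\in A$, the distribution $\mathbb Q^\star(\alpha)$ is a Nash strategy of nature. 2. If $\mathcal J_+$ has at least two elements and $\tilde\xi\ne0$, then the family $\{\mathbb Q^\star(\alpha):\alpha\in A\}$ has at least the cardinality of the continuum. 3. If $n\ge1$ and $\varepsilon>0$, then the set of Nash strategies of nature and the set of Nash equilibria each have at least the cardinality of the continuum. -/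

import Mathlib

open MeasureTheory
open scoped ENNReal NNReal RealInnerProductSpace Cardinal

noncomputable section

namespace DRSVM

section Game

variable {Z Θ : Type*} [MeasurableSpace Z]

/-- The transportation plans between `P` and `P'`: joint distributions with these marginals. -/
def couplings (P P' : Measure Z) : Set (Measure (Z × Z)) :=
  {π | IsProbabilityMeasure π ∧ π.map Prod.fst = P ∧ π.map Prod.snd = P'}

/-- The optimal transport discrepancy `d_c(P, P')`, with values in `[0, ∞]`. -/
def transportDiscrepancy (c : Z → Z → ℝ≥0∞) (P P' : Measure Z) : ℝ≥0∞ :=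
  ⨅ π ∈ couplings P P', ∫⁻ w, c w.1 w.2 ∂π

/-- Nature's feasible set: all probability distributions whose optimal transport discrepancy from
the reference distribution is at most `ε`. -/
def ambiguitySet (c : Z → Z → ℝ≥0∞) (Phat : Measure Z) (ε : ℝ≥0) : Set (Measure Z) :=
  {Q | IsProbabilityMeasure Q ∧ transportDiscrepancy c Q Phat ≤ (ε : ℝ≥0∞)}

/-- Nash equilibrium (saddle point) of the zero-sum game with payoff `E_{Z ∼ Q} [ℓ(θ, Z)]`, in
which the decision-maker minimizes over all `θ : Θ` and nature maximizes over `Q ∈ B`.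
The loss is nonnegative, so that its expectation is a well-defined element of `[0, ∞]`. -/
def IsNashEquilibrium (ℓ : Θ → Z → ℝ≥0∞) (B : Set (Measure Z)) (θs : Θ) (Qs : Measure Z) : Prop :=
  Qs ∈ B ∧
  (∀ Q ∈ B, ∫⁻ z, ℓ θs z ∂Q ≤ ∫⁻ z, ℓ θs z ∂Qs) ∧
  (∀ θ : Θ, ∫⁻ z, ℓ θs z ∂Qs ≤ ∫⁻ z, ℓ θ z ∂Qs)

/-- A Nash strategy of nature is nature's part of a Nash equilibrium. -/
def IsNashStrategy (ℓ : Θ → Z → ℝ≥0∞) (B : Set (Measure Z)) (Qs : Measure Z) : Prop :=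
  ∃ θs : Θ, IsNashEquilibrium ℓ B θs Qs

end Game

/-- The feature space `ℝⁿ`, used for its inner product; the transportation cost is measured with an
arbitrary further norm. -/
abbrev Feature (n : ℕ) : Type := EuclideanSpace ℝ (Fin n)

/-- The label space `{-1, +1}`. -/
abbrev Label : Type := ({-1, 1} : Set ℝ)

/-- The hinge loss `max {0, 1 - y ⟨θ, x⟩}`. -/
def hingeLoss {n : ℕ} (θ : Feature n) (z : Feature n × Label) : ℝ≥0∞ :=
  ENNReal.ofReal (max 0 (1 - (z.2 : ℝ) * ⟪θ, z.1⟫))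

open Classical in
/-- The label-preserving cost: `N (x₁ - x₂)` if the labels agree and `∞` otherwise. -/
def labelCost {n : ℕ} (N : Seminorm ℝ (Feature n)) (z₁ z₂ : Feature n × Label) : ℝ≥0∞ :=
  if z₁.2 = z₂.2 then ENNReal.ofReal (N (z₁.1 - z₂.1)) else ∞

section Samples

variable {n J : ℕ} (x : Fin J → Feature n) (y : Fin J → Label)

/-- The empirical (uniform) distribution on the samples `(x j, y j)`. -/
def empirical : Measure (Feature n × Label) :=
  ∑ j, ENNReal.ofReal (1 / (J : ℝ)) • Measure.dirac (x j, y j)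

/-- The feasible set of the finite convex program. -/
def programFeasible (N : Seminorm ℝ (Feature n)) (ε : ℝ≥0) : Set (Fin J → ℝ) :=
  {q | N (∑ j, (q j * (y j : ℝ)) • x j) ≤ (ε : ℝ) ∧ ∀ j, 0 ≤ q j ∧ q j ≤ 1 / (J : ℝ)}

/-- `q` solves the finite convex program: maximize `∑ j, q j` over the feasible set. -/
def SolvesProgram (N : Seminorm ℝ (Feature n)) (ε : ℝ≥0) (q : Fin J → ℝ) : Prop :=
  q ∈ programFeasible x y N ε ∧ ∀ q' ∈ programFeasible x y N ε, ∑ j, q' j ≤ ∑ j, q j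

/-- The index set `J₀`. -/
def indexZero (q : Fin J → ℝ) : Finset (Fin J) := Finset.univ.filter fun j => q j = 0

/-- The index set `J₊`. -/
def indexPos (q : Fin J → ℝ) : Finset (Fin J) := Finset.univ.filter fun j => 0 < q j

/-- The direction `ξ = - ∑ j, q j * y j * x j`. -/
def direction (q : Fin J → ℝ) : Feature n := -∑ j, (q j * (y j : ℝ)) • x j

/-- The set `A` of weight vectors: the probability simplex over `J₊`. -/
def weights (q : Fin J → ℝ) : Set (Fin J → ℝ) :=
  {α | (∀ j, 0 ≤ α j) ∧ ∑ j, α j = 1 ∧ ∀ j ∈ indexZero q, α j = 0}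

/-- The distribution `Q(α)`, which moves the mass `q j` from the sample `(x j, y j)` to
`(x j + α j * y j * ξ / q j, y j)` for every `j` in `J₊`. -/
def perturbed (q α : Fin J → ℝ) : Measure (Feature n × Label) :=
  (∑ j ∈ indexZero q, ENNReal.ofReal (1 / (J : ℝ)) • Measure.dirac (x j, y j)) +
  (∑ j ∈ indexPos q, ENNReal.ofReal (1 / (J : ℝ) - q j) • Measure.dirac (x j, y j)) +
  ∑ j ∈ indexPos q, ENNReal.ofReal (q j) •
    Measure.dirac (x j + (α j * (y j : ℝ) / q j) • direction x y q, y j)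

end Samples

end DRSVM

end

/-! Both players are tied to the optimal value `∑ j, q j` of the finite program. Its dual minimizes
the regularized empirical loss, empirical hinge loss plus `L * ε` with `⟪θ, v⟫ ≤ L * N v`, and
`exists_optimal_decision` gives a `θ` attaining at most `∑ j, q j`. The loss is Lipschitz in the
transport cost, so nature cannot get more than this against `θ`. Conversely, if nature moves the
masses `q j` so that `∑ j, q j * y j * (mean displaced x j)` vanishes, then `max 0 t ≥ t` on moved
mass and `≥ 0` elsewhere force a loss of at least `∑ j, q j` on every decision. Hence every balanced
perturbation within budget is a Nash strategy (`isNashStrategy_splitPerturbed`), and `Q(α)` is one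
of these.

For cardinality, distinct parameters might give equal measures, so injectivity is avoided: the
second moment is continuous and nonconstant along a path of strategies, hence takes a whole interval
of values. Splitting each moved mass into halves provides such a path even when `Q(α)` is constant.
-/

namespace DRSVM

open Filter Topology

/-! ### Strong duality for the finite program, with dual attainment. -/

section Duality

/-- **Farkas' lemma** for finitely many linear functionals on an arbitrary real vector space. -/
theorem farkas {ι V : Type*} [AddCommGroup V] [Module ℝ V] (s : Finset ι)
    (a : ι → V →ₗ[ℝ] ℝ) (b : V →ₗ[ℝ] ℝ) (h : ∀ v, (∀ i ∈ s, a i v ≤ 0) → b v ≤ 0) :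
    ∃ c : ι → ℝ, (∀ i, 0 ≤ c i) ∧ b = ∑ i ∈ s, c i • a i := by
  classical
  induction s using Finset.induction_on generalizing a b with
  | empty =>
    refine ⟨fun _ => 0, fun _ => le_rfl, LinearMap.ext fun v => ?_⟩
    have h₁ := h v (by simp)
    have h₂ := h (-v) (by simp)
    rw [map_neg] at h₂
    simpa using le_antisymm h₁ (by linarith)
  | insert k s hk ih =>
    by_cases hs : ∀ v, (∀ i ∈ s, a i v ≤ 0) → b v ≤ 0
    · obtain ⟨c, hc, rfl⟩ := ih a b hs
      refine ⟨fun i => if i = k then 0 else c i, fun i => ?_, ?_⟩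
      · dsimp only; split_ifs
        exacts [le_rfl, hc i]
      · rw [Finset.sum_insert hk]
        simp only [if_true, zero_smul, zero_add]
        refine Finset.sum_congr rfl fun i hi => ?_
        rw [if_neg (by rintro rfl; exact hk hi)]
    · push Not at hs
      obtain ⟨v₀, hv₀, hb₀⟩ := hs
      have hk₀ : 0 < a k v₀ := by
        by_contra! hle
        refine hb₀.not_ge (h v₀ fun i hi => ?_)
        rcases Finset.mem_insert.1 hi with rfl | hi
        exacts [hle, hv₀ i hi]
      -- Evaluating the reduced functionals at `v` is evaluating the original ones at the projection
      -- of `v` onto `ker (a k)` along `v₀`, where constraint `k` holds trivially.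
      obtain ⟨c, hc, hbc⟩ := ih (fun i => a i - (a i v₀ / a k v₀) • a k)
        (b - (b v₀ / a k v₀) • a k) fun v hv => by
          have := h (v - (a k v / a k v₀) • v₀) fun i hi => by
            rcases Finset.mem_insert.1 hi with rfl | hi
            · simp [hk₀.ne']
            · have := hv i hi
              simp only [LinearMap.sub_apply, LinearMap.smul_apply, smul_eq_mul, map_sub,
                map_smul] at this ⊢
              convert this using 2
              ring
          simp only [LinearMap.sub_apply, LinearMap.smul_apply, smul_eq_mul, map_sub,
            map_smul] at this ⊢
          convert this using 2
          ring
      refine ⟨fun i => if i = k then (b v₀ - ∑ j ∈ s, c j * a j v₀) / a k v₀ else c i,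
        fun i => ?_, ?_⟩
      · dsimp only; split_ifs
        · refine div_nonneg (sub_nonneg.2 (le_trans (Finset.sum_nonpos fun j hj => ?_) hb₀.le)) hk₀.le
          exact mul_nonpos_of_nonneg_of_nonpos (hc j) (hv₀ j hj)
        · exact hc i
      · rw [Finset.sum_insert hk]
        simp only [if_true]
        have hsum : ∑ i ∈ s, (if i = k then (b v₀ - ∑ j ∈ s, c j * a j v₀) / a k v₀ else c i) • a i
            = ∑ i ∈ s, c i • a i :=
          Finset.sum_congr rfl fun i hi => by rw [if_neg (by rintro rfl; exact hk hi)]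
        rw [hsum]
        ext v
        have := LinearMap.congr_fun hbc v
        simp only [LinearMap.sub_apply, LinearMap.smul_apply, smul_eq_mul, LinearMap.add_apply,
          LinearMap.sum_apply, mul_sub, Finset.sum_sub_distrib] at this ⊢
        have h₂ : ∑ j ∈ s, c j * (a j v₀ / a k v₀ * a k v)
            = (∑ j ∈ s, c j * a j v₀) / a k v₀ * a k v := by
          rw [Finset.sum_div, Finset.sum_mul]
          exact Finset.sum_congr rfl fun j _ => by ring
        rw [h₂] at this
        rw [sub_div, sub_mul]
        linarith

variable {n J : ℕ}

theorem seminorm_continuous (N : Seminorm ℝ (Feature n)) : Continuous N :=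
  continuousOn_univ.1 (N.convexOn.continuousOn isOpen_univ)

/-- A linear functional is bounded with respect to any norm on `ℝⁿ`. -/
theorem exists_inner_le (N : Seminorm ℝ (Feature n)) (hN : ∀ v, N v = 0 → v = 0) (θ : Feature n) :
    ∃ L : ℝ, 0 ≤ L ∧ ∀ v, ⟪θ, v⟫ ≤ L * N v := by
  rcases subsingleton_or_nontrivial (Feature n) with hE | hE
  · refine ⟨0, le_rfl, fun v => ?_⟩
    rw [Subsingleton.elim v 0]; simp
  obtain ⟨u, hu, hmin⟩ := (isCompact_sphere (0 : Feature n) 1).exists_isMinOn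
    (NormedSpace.sphere_nonempty.2 zero_le_one) (seminorm_continuous N).continuousOn
  have hNu : 0 < N u := lt_of_le_of_ne (apply_nonneg N u) fun h => by
    have := hN u h.symm
    simp [this] at hu
  refine ⟨‖θ‖ / N u, by positivity, fun v => ?_⟩
  rcases eq_or_ne v 0 with rfl | hv
  · simp
  have hv' : 0 < ‖v‖ := norm_pos_iff.2 hv
  have h₁ : N u ≤ N ((‖v‖⁻¹ : ℝ) • v) := hmin (by simp [norm_smul, hv'.ne'])
  rw [map_smul_eq_mul, Real.norm_eq_abs, abs_of_pos (inv_pos.2 hv'), inv_mul_eq_div,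
    le_div_iff₀ hv'] at h₁
  calc ⟪θ, v⟫ ≤ ‖θ‖ * ‖v‖ := real_inner_le_norm θ v
    _ = ‖θ‖ / N u * (N u * ‖v‖) := by field_simp
    _ ≤ ‖θ‖ / N u * N v := by gcongr

/-- Multipliers for the finite program whose norm constraint forces a linear equation. -/
theorem exists_multiplier_zero (a : Fin J → Feature n) (q : Fin J → ℝ) {β : ℝ} (hβ : 0 < β)
    (hq : ∑ j, q j • a j = 0) (hq₀ : ∀ j, 0 ≤ q j ∧ q j ≤ β)
    (hmax : ∀ q' : Fin J → ℝ, ∑ j, q' j • a j = 0 → (∀ j, 0 ≤ q' j ∧ q' j ≤ β) →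
      ∑ j, q' j ≤ ∑ j, q j) :
    ∃ θ : Feature n, ∑ j, β * max 0 (1 - ⟪θ, a j⟫) ≤ ∑ j, q j := by
  classical
  let φ : Fin J → (Feature n × ℝ) →ₗ[ℝ] ℝ := fun j =>
    LinearMap.snd ℝ _ _ - (innerSL ℝ (a j)).toLinearMap ∘ₗ LinearMap.fst ℝ _ _
  have hφ : ∀ j w, φ j w = w.2 - ⟪w.1, a j⟫ := fun j w => by
    simp [φ, real_inner_comm]
  -- Homogenized complementary slackness for `w = (θ, s)`: `s ≤ ⟪θ, a j⟫` when `q j < β`, and `⟪θ, a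
  -- j⟫ ≤ s` when `0 < q j`. A zero functional stands for an absent condition. A solution with `s >
  -- 0` can be rescaled to `s = 1`.
  let A : Fin J × Bool → (Feature n × ℝ) →ₗ[ℝ] ℝ := fun p =>
    if p.2 then (if q p.1 < β then φ p.1 else 0) else (if 0 < q p.1 then -φ p.1 else 0)
  by_cases hex : ∃ w : Feature n × ℝ, (∀ p, A p w ≤ 0) ∧ 0 < w.2
  · obtain ⟨w, hw, hw₂⟩ := hex
    have hlow : ∀ j, q j < β → w.2 ≤ ⟪w.1, a j⟫ := fun j hj => by
      have := hw (j, true)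
      simp only [A, if_true, if_pos hj, hφ] at this
      linarith
    have hupp : ∀ j, 0 < q j → ⟪w.1, a j⟫ ≤ w.2 := fun j hj => by
      have := hw (j, false)
      simp only [A, Bool.false_eq_true, if_false, if_pos hj, LinearMap.neg_apply, hφ] at this
      linarith
    refine ⟨w.2⁻¹ • w.1, ?_⟩
    have key : ∀ j, β * max 0 (1 - ⟪w.2⁻¹ • w.1, a j⟫) = q j - ⟪w.2⁻¹ • w.1, q j • a j⟫ := by
      intro j
      rw [real_inner_smul_left, real_inner_smul_left, real_inner_smul_right, inv_mul_eq_div]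
      rcases (hq₀ j).1.eq_or_lt with h0 | h0
      · rw [max_eq_left, ← h0]
        · simp
        · have := hlow j (h0 ▸ hβ)
          rw [sub_nonpos, le_div_iff₀ hw₂]; linarith
      · have h₁ : ⟪w.1, a j⟫ / w.2 ≤ 1 := by
          rw [div_le_iff₀ hw₂]; linarith [hupp j h0]
        rw [max_eq_right (by linarith)]
        rcases (hq₀ j).2.eq_or_lt with h2 | h2
        · rw [h2]; ring
        · have h₂ : ⟪w.1, a j⟫ / w.2 = 1 := le_antisymm h₁ (by
            rw [le_div_iff₀ hw₂]; linarith [hlow j h2])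
          have h₃ := (div_eq_one_iff_eq hw₂.ne').1 h₂
          rw [h₂, h₃]; field_simp; ring
    rw [Finset.sum_congr rfl fun j _ => key j, Finset.sum_sub_distrib, ← inner_sum, hq]
    simp
  · push Not at hex
    obtain ⟨c, hc, hcA⟩ := farkas Finset.univ A (LinearMap.snd ℝ (Feature n) ℝ)
      fun w hw => hex w fun p => hw p (Finset.mem_univ p)
    -- If no solution has `s > 0`, the Farkas coefficients form a feasible ascent direction at `q`:
    -- `∑ d j = 1`, `∑ d j • a j = 0`, and `d j` points into the box at active bounds. This
    -- contradicts optimality.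
    let d : Fin J → ℝ := fun j =>
      (if q j < β then c (j, true) else 0) - (if 0 < q j then c (j, false) else 0)
    have hd : ∀ w : Feature n × ℝ, w.2 = ∑ j, d j * (w.2 - ⟪w.1, a j⟫) := by
      intro w
      have := LinearMap.congr_fun hcA w
      rw [LinearMap.snd_apply, LinearMap.sum_apply, Fintype.sum_prod_type] at this
      refine this.trans (Finset.sum_congr rfl fun j _ => ?_)
      simp only [Fintype.sum_bool, LinearMap.smul_apply, smul_eq_mul, A, if_true, Bool.false_eq_true,
        if_false, d]
      split_ifs <;> simp [hφ] <;> ring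
    have hd₁ : ∑ j, d j = 1 := by
      have := hd (0, 1)
      simpa using this.symm
    have hd₂ : ∑ j, d j • a j = 0 := by
      have := hd (∑ j, d j • a j, 0)
      simp only [zero_sub, mul_neg, Finset.sum_neg_distrib, ← real_inner_smul_right] at this
      rw [← inner_sum] at this
      exact inner_self_eq_zero.1 (neg_eq_zero.1 this.symm)
    have hsmall : ∀ᶠ t in 𝓝[>] (0 : ℝ), ∀ j, 0 ≤ q j + t * d j ∧ q j + t * d j ≤ β := by
      refine eventually_all.2 fun j => ?_
      have hlim : Tendsto (fun t : ℝ => q j + t * d j) (𝓝[>] 0) (𝓝 (q j)) := by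
        have : Continuous fun t : ℝ => q j + t * d j := by fun_prop
        simpa using (this.tendsto 0).mono_left nhdsWithin_le_nhds
      have hpos : ∀ᶠ t in 𝓝[>] (0 : ℝ), 0 < t := self_mem_nhdsWithin
      refine Eventually.and ?_ ?_
      · rcases (hq₀ j).1.eq_or_lt with h | h
        · filter_upwards [hpos] with t ht
          have : 0 ≤ d j := by
            simp only [d, ← h, lt_irrefl, if_false, hβ, if_true, sub_zero]; exact hc _
          rw [← h]; positivity
        · exact (hlim.eventually_const_lt h).mono fun t ht => ht.le
      · rcases (hq₀ j).2.eq_or_lt with h | h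
        · filter_upwards [hpos] with t ht
          have : d j ≤ 0 := by
            simp only [d, h, lt_irrefl, if_false, hβ, if_true, zero_sub, neg_nonpos]; exact hc _
          rw [h]; nlinarith
        · exact (hlim.eventually_lt_const h).mono fun t ht => ht.le
    obtain ⟨t, ht, ht₀⟩ := (hsmall.and self_mem_nhdsWithin).exists
    have := hmax (fun j => q j + t * d j) (by
      simp only [add_smul, mul_smul, Finset.sum_add_distrib, ← Finset.smul_sum, hq, hd₂]; simp) ht
    rw [Finset.sum_add_distrib, ← Finset.mul_sum, hd₁] at this
    have : (0 : ℝ) < t := ht₀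
    linarith

/-- Multipliers for the finite program in the presence of a Slater point. -/
theorem exists_multiplier_pos (N : Seminorm ℝ (Feature n)) (hN : ∀ v, N v = 0 → v = 0)
    (a : Fin J → Feature n) (V : ℝ) {β ε : ℝ} (hβ : 0 ≤ β) (hε : 0 < ε) (hV : 0 ≤ V)
    (hmax : ∀ q : Fin J → ℝ, N (∑ j, q j • a j) ≤ ε → (∀ j, 0 ≤ q j ∧ q j ≤ β) →
      ∑ j, q j ≤ V) :
    ∃ (θ : Feature n) (L : ℝ), 0 ≤ L ∧ (∀ v, ⟪θ, v⟫ ≤ L * N v) ∧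
      ∑ j, β * max 0 (1 - ⟪θ, a j⟫) + L * ε ≤ V := by
  have hNc := seminorm_continuous N
  -- The strict hypograph of the value function under a shift of the norm constraint. Strict
  -- inequalities make it open, so it can be separated from `(0, V)`.
  let C : Set (Feature n × ℝ) :=
    {p | ∃ q : Fin J → ℝ, (∀ j, 0 ≤ q j ∧ q j ≤ β) ∧ N (p.1 - ∑ j, q j • a j) < ε ∧
      p.2 < ∑ j, q j}
  have hCo : IsOpen C := by
    have : C = ⋃ q ∈ {q : Fin J → ℝ | ∀ j, 0 ≤ q j ∧ q j ≤ β},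
        {p : Feature n × ℝ | N (p.1 - ∑ j, q j • a j) < ε ∧ p.2 < ∑ j, q j} := by
      ext p; simp [C, and_left_comm]
    rw [this]
    refine isOpen_biUnion fun q _ => IsOpen.inter ?_ ?_
    · exact isOpen_lt (hNc.comp (by fun_prop)) continuous_const
    · exact isOpen_lt continuous_snd continuous_const
  have hCc : Convex ℝ C := by
    rintro p ⟨q, hq, hp, hp'⟩ p' ⟨q', hq', hp₂, hp₂'⟩ s t hs ht hst
    refine ⟨fun j => s * q j + t * q' j, fun j => ⟨?_, ?_⟩, ?_, ?_⟩
    · have := (hq j).1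
      have := (hq' j).1
      positivity
    · have h₁ := mul_le_mul_of_nonneg_left (hq j).2 hs
      have h₂ := mul_le_mul_of_nonneg_left (hq' j).2 ht
      nlinarith
    · have heq : (s • p + t • p').1 - ∑ j, (s * q j + t * q' j) • a j =
          s • (p.1 - ∑ j, q j • a j) + t • (p'.1 - ∑ j, q' j • a j) := by
        simp only [add_smul, mul_smul, Finset.sum_add_distrib, ← Finset.smul_sum, Prod.fst_add,
          Prod.smul_fst, smul_sub]
        abel
      rw [heq]
      have := (convex_Iio ε) hp hp₂ hs ht hst
      refine lt_of_le_of_lt (map_add_le_add N _ _) ?_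
      rw [map_smul_eq_mul, map_smul_eq_mul, Real.norm_of_nonneg hs, Real.norm_of_nonneg ht]
      exact this
    · have hlt : s * p.2 + t * p'.2 < s * ∑ j, q j + t * ∑ j, q' j := by
        rcases hs.eq_or_lt with rfl | hs
        · have : t = 1 := by linarith
          subst this; simpa using hp₂'
        · exact add_lt_add_of_lt_of_le (mul_lt_mul_of_pos_left hp' hs)
            (mul_le_mul_of_nonneg_left hp₂'.le ht)
      simpa [Finset.sum_add_distrib, Finset.mul_sum] using hlt
  have hCV : ((0 : Feature n), V) ∉ C := by
    rintro ⟨q, hq, hq₁, hq₂⟩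
    rw [zero_sub, map_neg_eq_map] at hq₁
    exact hq₂.not_ge (hmax q hq₁.le hq)
  obtain ⟨f, hf⟩ := geometric_hahn_banach_open_point hCc hCo hCV
  set r : ℝ := f (0, 1) with hr
  set g : Feature n := (InnerProductSpace.toDual ℝ (Feature n)).symm
    (f.comp (ContinuousLinearMap.inl ℝ (Feature n) ℝ)) with hg
  have hfg : ∀ w s, f (w, s) = ⟪g, w⟫ + s * r := by
    intro w s
    have : (w, s) = ContinuousLinearMap.inl ℝ (Feature n) ℝ w + s • ((0 : Feature n), (1 : ℝ)) := by
      simp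
    rw [this, map_add, map_smul, hg, InnerProductSpace.toDual_symm_apply]
    rfl
  -- The hyperplane is not vertical: `q = 0` is a Slater point because `ε > 0`.
  have hr₀ : 0 < r := by
    have := hf (0, -1) ⟨fun _ => 0, fun _ => ⟨le_rfl, hβ⟩, by simpa using hε, by simp⟩
    rw [hfg, hfg] at this
    simp only [inner_zero_right, zero_add] at this
    nlinarith
  have hmain : ∀ q : Fin J → ℝ, (∀ j, 0 ≤ q j ∧ q j ≤ β) → ∀ u, N u < ε →
      ⟪g, ∑ j, q j • a j + u⟫ + (∑ j, q j) * r ≤ V * r := by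
    intro q hq u hu
    refine le_of_forall_pos_lt_add fun δ hδ => ?_
    have := hf (∑ j, q j • a j + u, ∑ j, q j - δ / r)
      ⟨q, hq, by simpa using hu, by linarith [div_pos hδ hr₀]⟩
    rw [hfg, hfg, inner_zero_right, zero_add, sub_mul, div_mul_cancel₀ _ hr₀.ne'] at this
    linarith
  let θ : Feature n := -(r⁻¹ • g)
  have hθ : ∀ q : Fin J → ℝ, (∀ j, 0 ≤ q j ∧ q j ≤ β) → ∀ u, N u < ε →
      ∑ j, q j * (1 - ⟪θ, a j⟫) + ⟪θ, u⟫ ≤ V := by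
    intro q hq u hu
    have h₁ := hmain q hq (-u) (by rwa [map_neg_eq_map])
    have h₂ : ∀ w, ⟪θ, w⟫ = -(⟪g, w⟫ / r) := fun w => by
      simp only [θ, inner_neg_left, real_inner_smul_left]; ring
    simp only [mul_sub, mul_one, Finset.sum_sub_distrib, ← real_inner_smul_right]
    rw [← inner_sum, h₂, h₂]
    rw [inner_add_right, inner_neg_right] at h₁
    have h₃ : (⟪g, ∑ j, q j • a j⟫ + -⟪g, u⟫ + (∑ j, q j) * r) / r ≤ V := by
      rw [div_le_iff₀ hr₀]; exact h₁
    have h₄ : (⟪g, ∑ j, q j • a j⟫ + -⟪g, u⟫ + (∑ j, q j) * r) / r =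
      ⟪g, ∑ j, q j • a j⟫ / r - ⟪g, u⟫ / r + ∑ j, q j := by field_simp; ring
    linarith
  set H : ℝ := ∑ j, β * max 0 (1 - ⟪θ, a j⟫) with hH
  have hHu : ∀ u, N u < ε → H + ⟪θ, u⟫ ≤ V := by
    intro u hu
    -- This `q` maximizes the linear expression over the box and turns it into the hinge sum.
    refine le_trans (le_of_eq ?_) (hθ (fun j => if ⟪θ, a j⟫ ≤ 1 then β else 0) (fun j => ?_) u hu)
    · congr 1
      refine Finset.sum_congr rfl fun j _ => ?_
      split_ifs with h
      · rw [max_eq_right (by linarith)]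
      · rw [max_eq_left (by linarith), mul_zero, zero_mul]
    · split_ifs <;> simp [hβ]
  have hHV : H ≤ V := by simpa using hHu 0 (by simpa using hε)
  -- This `L` makes `H + L * ε = V`; the bound on `⟪θ, v⟫` follows by rescaling `v` to `N`-length
  -- just below `ε` in `hHu`.
  refine ⟨θ, (V - H) / ε, div_nonneg (sub_nonneg.2 hHV) hε.le, fun v => ?_, ?_⟩
  · rcases eq_or_ne v 0 with rfl | hv
    · simp
    have hNv : 0 < N v := lt_of_le_of_ne (apply_nonneg N v) fun h => hv (hN v h.symm)
    rw [div_mul_eq_mul_div, le_div_iff₀ hε]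
    by_contra! hlt
    have hpos : 0 < ⟪θ, v⟫ := by
      have : 0 ≤ (V - H) * N v := mul_nonneg (sub_nonneg.2 hHV) hNv.le
      exact pos_of_mul_pos_left (this.trans_lt hlt) hε.le
    obtain ⟨s, hs₁, hs₂⟩ := exists_between ((div_lt_iff₀ hpos).2 (by rwa [mul_comm ε]))
    have hs₀ : 0 ≤ s :=
      (div_nonneg (mul_nonneg (sub_nonneg.2 hHV) hNv.le) hpos.le).trans hs₁.le
    have := hHu ((s / N v) • v) (by
      rw [map_smul_eq_mul, Real.norm_of_nonneg (by positivity), div_mul_cancel₀ _ hNv.ne']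
      exact hs₂)
    rw [real_inner_smul_right] at this
    rw [div_lt_iff₀ hpos] at hs₁
    have h₂ : s / N v * ⟪θ, v⟫ ≤ V - H := by linarith
    rw [div_mul_eq_mul_div, div_le_iff₀ hNv] at h₂
    linarith
  · rw [div_mul_cancel₀ _ hε.ne']; linarith

/-- Strong duality for the finite program, with attainment on the side of the decision-maker. -/
theorem exists_optimal_decision (hJ : 0 < J) (N : Seminorm ℝ (Feature n))
    (hN : ∀ v, N v = 0 → v = 0) (x : Fin J → Feature n) (y : Fin J → Label) (ε : ℝ≥0)
    (q : Fin J → ℝ) (hq : SolvesProgram x y N ε q) :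
    ∃ (θ : Feature n) (L : ℝ), 0 ≤ L ∧ (∀ v, ⟪θ, v⟫ ≤ L * N v) ∧
      ∑ j, 1 / (J : ℝ) * max 0 (1 - (y j : ℝ) * ⟪θ, x j⟫) + L * ε ≤ ∑ j, q j := by
  have hβ : 0 < 1 / (J : ℝ) := by positivity
  obtain ⟨⟨hq₁, hq₂⟩, hq₃⟩ := hq
  simp only [← real_inner_smul_right]
  simp only [mul_smul] at hq₁
  have hfeas : ∀ q' : Fin J → ℝ, N (∑ j, q' j • (y j : ℝ) • x j) ≤ ε →
      (∀ j, 0 ≤ q' j ∧ q' j ≤ 1 / (J : ℝ)) → ∑ j, q' j ≤ ∑ j, q j := fun q' h₁ h₂ =>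
    hq₃ q' ⟨by simpa only [mul_smul] using h₁, h₂⟩
  -- For `ε = 0` there is no Slater point, but definiteness of `N` turns the constraint into a
  -- linear equation, so the polyhedral argument applies.
  rcases (zero_le : 0 ≤ ε).eq_or_lt with rfl | hε
  · obtain ⟨θ, hθ⟩ := exists_multiplier_zero (fun j => (y j : ℝ) • x j) q hβ
      (hN _ (le_antisymm hq₁ (apply_nonneg N _))) hq₂
      fun q' h₁ h₂ => hfeas q' (by rw [h₁]; simp) h₂
    obtain ⟨L, hL, hLN⟩ := exists_inner_le N hN θ
    exact ⟨θ, L, hL, hLN, by simpa using hθ⟩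
  · exact exists_multiplier_pos N hN (fun j => (y j : ℝ) • x j) (∑ j, q j) hβ.le hε
      (Finset.sum_nonneg fun j _ => (hq₂ j).1) hfeas

end Duality


/-! ### Three-atom discrete measures: integrals and images. -/

section SplitMeasure

variable {X Y : Type*} [MeasurableSpace X] [MeasurableSpace Y] {J : ℕ}

/-- The discrete measure with masses `A j`, `B j`, `B j` at the points `u j`, `v j`, `w j`. -/
noncomputable def splitMeasure (A B : Fin J → ℝ≥0∞) (u v w : Fin J → X) : Measure X :=
  ∑ j, (A j • Measure.dirac (u j) + B j • Measure.dirac (v j) + B j • Measure.dirac (w j))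

theorem lintegral_splitMeasure [MeasurableSingletonClass X] (A B : Fin J → ℝ≥0∞)
    (u v w : Fin J → X) (f : X → ℝ≥0∞) :
    ∫⁻ z, f z ∂splitMeasure A B u v w = ∑ j, (A j * f (u j) + B j * f (v j) + B j * f (w j)) := by
  simp [splitMeasure, lintegral_finsetSum_measure, lintegral_add_measure]

theorem map_splitMeasure {f : X → Y} (hf : Measurable f) (A B : Fin J → ℝ≥0∞)
    (u v w : Fin J → X) :
    (splitMeasure A B u v w).map f =
      splitMeasure A B (fun j => f (u j)) (fun j => f (v j)) (fun j => f (w j)) := by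
  simp only [splitMeasure, ← Measure.mapₗ_apply_of_measurable hf, map_sum, map_add,
    LinearMap.map_smul_of_tower]
  simp [Measure.mapₗ_apply_of_measurable hf, Measure.map_dirac' hf]

end SplitMeasure

/-! ### Weak duality and the balanced perturbations as Nash strategies. -/

section Equilibrium

variable {n J : ℕ}

theorem measurable_hingeLoss (θ : Feature n) : Measurable (hingeLoss θ) := by
  unfold hingeLoss
  fun_prop

theorem label_eq (b : Label) : (b : ℝ) = -1 ∨ (b : ℝ) = 1 := b.2

theorem label_mul_self (b : Label) : (b : ℝ) * b = 1 := by
  rcases label_eq b with h | h <;> rw [h] <;> norm_num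

theorem map_label_smul (N : Seminorm ℝ (Feature n)) (b : Label) (v : Feature n) :
    N ((b : ℝ) • v) = N v := by
  rcases label_eq b with h | h <;> rw [h] <;> simp

/-- The hinge loss is Lipschitz with respect to the transportation cost. -/
theorem hingeLoss_le_add (N : Seminorm ℝ (Feature n)) {θ : Feature n} {L : ℝ} (hL : 0 < L)
    (hθ : ∀ v, ⟪θ, v⟫ ≤ L * N v) (z z' : Feature n × Label) :
    hingeLoss θ z ≤ hingeLoss θ z' + ENNReal.ofReal L * labelCost N z z' := by
  unfold hingeLoss labelCost
  split_ifs with h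
  · rw [← ENNReal.ofReal_mul hL.le, ← ENNReal.ofReal_add (le_max_left _ _)
      (mul_nonneg hL.le (apply_nonneg N _))]
    refine ENNReal.ofReal_le_ofReal ?_
    have h₁ := hθ ((z'.2 : ℝ) • (z'.1 - z.1))
    rw [map_label_smul, map_sub_rev, real_inner_smul_right, inner_sub_right] at h₁
    rw [h]
    have h₂ := apply_nonneg N (z.1 - z'.1)
    have h₃ := le_max_left 0 (1 - (z'.2 : ℝ) * ⟪θ, z'.1⟫)
    have h₄ := le_max_right 0 (1 - (z'.2 : ℝ) * ⟪θ, z'.1⟫)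
    refine max_le (by positivity) ?_
    nlinarith
  -- Strict positivity of `L` matters here, since `0 * ∞ = 0`.
  · rw [ENNReal.mul_top (by simpa using hL)]
    simp

theorem empirical_eq_splitMeasure (x : Fin J → Feature n) (y : Fin J → Label) {A B : Fin J → ℝ≥0∞}
    (hAB : ∀ j, A j + B j + B j = ENNReal.ofReal (1 / (J : ℝ))) :
    splitMeasure A B (fun j => (x j, y j)) (fun j => (x j, y j)) (fun j => (x j, y j)) =
      empirical x y := by
  simp only [splitMeasure, empirical, ← add_smul, hAB]

theorem lintegral_hingeLoss_empirical (x : Fin J → Feature n) (y : Fin J → Label) (θ : Feature n) :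
    ∫⁻ z, hingeLoss θ z ∂empirical x y =
      ENNReal.ofReal (∑ j, 1 / (J : ℝ) * max 0 (1 - (y j : ℝ) * ⟪θ, x j⟫)) := by
  rw [ENNReal.ofReal_sum_of_nonneg fun j _ => by positivity]
  simp [empirical, lintegral_finsetSum_measure, hingeLoss, ENNReal.ofReal_mul]

/-- The worst-case expected hinge loss over the ambiguity set is at most the regularized
empirical loss. -/
theorem lintegral_hingeLoss_le_of_mem_ambiguitySet (N : Seminorm ℝ (Feature n))
    (x : Fin J → Feature n) (y : Fin J → Label) (ε : ℝ≥0) {θ : Feature n} {L : ℝ} (hL : 0 ≤ L)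
    (hθ : ∀ v, ⟪θ, v⟫ ≤ L * N v) {Q : Measure (Feature n × Label)}
    (hQ : Q ∈ ambiguitySet (labelCost N) (empirical x y) ε) :
    ∫⁻ z, hingeLoss θ z ∂Q ≤
      ENNReal.ofReal (∑ j, 1 / (J : ℝ) * max 0 (1 - (y j : ℝ) * ⟪θ, x j⟫) + L * ε) := by
  set H : ℝ := ∑ j, 1 / (J : ℝ) * max 0 (1 - (y j : ℝ) * ⟪θ, x j⟫) with hH
  have hH₀ : 0 ≤ H := Finset.sum_nonneg fun j _ => by positivity
  -- The slack `η` has two uses: `L + η` is positive, as the Lipschitz bound requires, and `ε + η`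
  -- exceeds the infimum, so some coupling costs less without assuming that the infimum is attained.
  have hlim : Tendsto (fun η : ℝ => ENNReal.ofReal (H + (L + η) * (ε + η))) (𝓝[>] 0)
      (𝓝 (ENNReal.ofReal (H + L * ε))) := by
    have : Continuous fun η : ℝ => ENNReal.ofReal (H + (L + η) * (ε + η)) :=
      ENNReal.continuous_ofReal.comp (by fun_prop)
    simpa using (this.tendsto 0).mono_left nhdsWithin_le_nhds
  refine ge_of_tendsto hlim ?_
  filter_upwards [self_mem_nhdsWithin] with η (hη : 0 < η)
  have hlt : transportDiscrepancy (labelCost N) Q (empirical x y) < ENNReal.ofReal (ε + η) := by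
    refine hQ.2.trans_lt ?_
    rw [← ENNReal.ofReal_coe_nnreal]
    exact ENNReal.ofReal_lt_ofReal_iff'.2 ⟨by linarith, by positivity⟩
  simp only [transportDiscrepancy, iInf_lt_iff] at hlt
  obtain ⟨π, ⟨-, hπ₁, hπ₂⟩, hπ⟩ := hlt
  calc ∫⁻ z, hingeLoss θ z ∂Q = ∫⁻ w, hingeLoss θ w.1 ∂π := by
        rw [← hπ₁, lintegral_map (measurable_hingeLoss θ) measurable_fst]
    _ ≤ ∫⁻ w, (hingeLoss θ w.2 + ENNReal.ofReal (L + η) * labelCost N w.1 w.2) ∂π :=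
        lintegral_mono fun w => hingeLoss_le_add N (by linarith)
          (fun v => (hθ v).trans (by nlinarith [apply_nonneg N v])) _ _
    _ = ENNReal.ofReal H + ENNReal.ofReal (L + η) * ∫⁻ w, labelCost N w.1 w.2 ∂π := by
        rw [lintegral_add_left (f := fun w : (Feature n × Label) × (Feature n × Label) => hingeLoss θ w.2)
            ((measurable_hingeLoss θ).comp measurable_snd),
          lintegral_const_mul' _ _ ENNReal.ofReal_ne_top, hH, ← lintegral_hingeLoss_empirical,
          ← hπ₂, lintegral_map (measurable_hingeLoss θ) measurable_snd]
    _ ≤ ENNReal.ofReal H + ENNReal.ofReal (L + η) * ENNReal.ofReal (ε + η) := by gcongr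
    _ = ENNReal.ofReal (H + (L + η) * (ε + η)) := by
        rw [← ENNReal.ofReal_mul (by positivity), ← ENNReal.ofReal_add hH₀ (by positivity)]

/-- The distribution obtained from the empirical one by keeping the mass `1 / J - q j` at the
sample `(x j, y j)` and moving one half of the mass `q j` by `d j`, the other half by `e j`. -/
noncomputable def splitPerturbed (x : Fin J → Feature n) (y : Fin J → Label) (q : Fin J → ℝ)
    (d e : Fin J → Feature n) : Measure (Feature n × Label) :=
  splitMeasure (fun j => ENNReal.ofReal (1 / (J : ℝ) - q j)) (fun j => ENNReal.ofReal (q j / 2))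
    (fun j => (x j, y j)) (fun j => (x j + d j, y j)) (fun j => (x j + e j, y j))

theorem lintegral_splitPerturbed_ofReal (x : Fin J → Feature n) (y : Fin J → Label)
    {q : Fin J → ℝ} (hq : ∀ j, 0 ≤ q j ∧ q j ≤ 1 / (J : ℝ)) (d e : Fin J → Feature n)
    {f : Feature n × Label → ℝ} (hf : ∀ z, 0 ≤ f z) :
    ∫⁻ z, ENNReal.ofReal (f z) ∂splitPerturbed x y q d e =
      ENNReal.ofReal (∑ j, ((1 / (J : ℝ) - q j) * f (x j, y j) + q j / 2 * f (x j + d j, y j) +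
        q j / 2 * f (x j + e j, y j))) := by
  have h₁ : ∀ j, 0 ≤ 1 / (J : ℝ) - q j := fun j => sub_nonneg.2 (hq j).2
  have h₂ : ∀ j, 0 ≤ q j / 2 := fun j => div_nonneg (hq j).1 zero_le_two
  have h₃ : ∀ j z, 0 ≤ (1 / (J : ℝ) - q j) * f z := fun j z => mul_nonneg (h₁ j) (hf z)
  have h₄ : ∀ j z, 0 ≤ q j / 2 * f z := fun j z => mul_nonneg (h₂ j) (hf z)
  rw [splitPerturbed, lintegral_splitMeasure, ENNReal.ofReal_sum_of_nonneg fun j _ =>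
    add_nonneg (add_nonneg (h₃ _ _) (h₄ _ _)) (h₄ _ _)]
  refine Finset.sum_congr rfl fun j _ => ?_
  rw [ENNReal.ofReal_add (add_nonneg (h₃ _ _) (h₄ _ _)) (h₄ _ _),
    ENNReal.ofReal_add (h₃ _ _) (h₄ _ _), ENNReal.ofReal_mul (h₁ j), ENNReal.ofReal_mul (h₂ j),
    ENNReal.ofReal_mul (h₂ j)]

/-- Pairing each atom with the sample it came from gives a coupling that preserves labels and has
exactly the stated cost. -/
theorem splitPerturbed_mem_ambiguitySet (hJ : 0 < J) (N : Seminorm ℝ (Feature n))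
    (x : Fin J → Feature n) (y : Fin J → Label) (ε : ℝ≥0) {q : Fin J → ℝ}
    (hq : ∀ j, 0 ≤ q j ∧ q j ≤ 1 / (J : ℝ)) {d e : Fin J → Feature n}
    (hcost : ∑ j, q j / 2 * (N (d j) + N (e j)) ≤ ε) :
    splitPerturbed x y q d e ∈ ambiguitySet (labelCost N) (empirical x y) ε := by
  have h₁ : ∀ j, 0 ≤ 1 / (J : ℝ) - q j := fun j => sub_nonneg.2 (hq j).2
  have h₂ : ∀ j, 0 ≤ q j / 2 := fun j => div_nonneg (hq j).1 zero_le_two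
  have hprob : IsProbabilityMeasure (splitPerturbed x y q d e) := by
    refine ⟨?_⟩
    have := lintegral_splitPerturbed_ofReal x y hq d e (f := fun _ => 1) fun _ => zero_le_one
    simp only [ENNReal.ofReal_one, lintegral_const, one_mul, mul_one] at this
    rw [this, ← ENNReal.ofReal_one]
    congr 1
    have : ∀ j, 1 / (J : ℝ) - q j + q j / 2 + q j / 2 = 1 / J := fun j => by ring
    simp only [this]
    simp [hJ.ne']
  refine ⟨hprob, ?_⟩
  set π : Measure ((Feature n × Label) × (Feature n × Label)) :=
    splitMeasure (fun j => ENNReal.ofReal (1 / (J : ℝ) - q j)) (fun j => ENNReal.ofReal (q j / 2))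
      (fun j => ((x j, y j), (x j, y j))) (fun j => ((x j + d j, y j), (x j, y j)))
      (fun j => ((x j + e j, y j), (x j, y j))) with hπ
  have hfst : π.map Prod.fst = splitPerturbed x y q d e := by
    rw [hπ, map_splitMeasure measurable_fst, splitPerturbed]
  have hsnd : π.map Prod.snd = empirical x y := by
    rw [hπ, map_splitMeasure measurable_snd]
    refine empirical_eq_splitMeasure x y fun j => ?_
    rw [← ENNReal.ofReal_add (h₁ j) (h₂ j), ← ENNReal.ofReal_add (add_nonneg (h₁ j) (h₂ j)) (h₂ j)]
    congr 1; ring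
  have hmem : π ∈ couplings (splitPerturbed x y q d e) (empirical x y) := by
    refine ⟨⟨?_⟩, hfst, hsnd⟩
    have := hprob.measure_univ
    rwa [← hfst, Measure.map_apply measurable_fst MeasurableSet.univ, Set.preimage_univ] at this
  refine (iInf₂_le π hmem).trans ?_
  rw [hπ, lintegral_splitMeasure, ← ENNReal.ofReal_coe_nnreal]
  refine le_trans (le_of_eq ?_) (ENNReal.ofReal_le_ofReal hcost)
  rw [ENNReal.ofReal_sum_of_nonneg fun j _ =>
    mul_nonneg (h₂ j) (add_nonneg (apply_nonneg N _) (apply_nonneg N _))]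
  refine Finset.sum_congr rfl fun j _ => ?_
  rw [ENNReal.ofReal_mul (h₂ j), ENNReal.ofReal_add (apply_nonneg N _) (apply_nonneg N _)]
  simp [labelCost, mul_add]

/-- The optimal value of the program bounds the expected loss of every decision against a
perturbation that balances the first moments. -/
theorem le_lintegral_hingeLoss_splitPerturbed (x : Fin J → Feature n) (y : Fin J → Label)
    {q : Fin J → ℝ} (hq : ∀ j, 0 ≤ q j ∧ q j ≤ 1 / (J : ℝ)) {d e : Fin J → Feature n}
    (hmean : ∑ j, (q j * (y j : ℝ) / 2) • (d j + e j) = direction x y q) (θ : Feature n) :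
    ENNReal.ofReal (∑ j, q j) ≤ ∫⁻ z, hingeLoss θ z ∂splitPerturbed x y q d e := by
  unfold hingeLoss
  rw [lintegral_splitPerturbed_ofReal x y hq d e
    (f := fun z => max 0 (1 - (z.2 : ℝ) * ⟪θ, z.1⟫)) fun _ => le_max_left _ _]
  refine ENNReal.ofReal_le_ofReal ?_
  have hzero : ∑ j, ((q j * (y j : ℝ)) • x j + (q j * (y j : ℝ) / 2) • (d j + e j)) = 0 := by
    rw [Finset.sum_add_distrib, hmean, direction, add_neg_cancel]
  -- By the balance condition the terms containing `θ` cancel, leaving the same constant for every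
  -- `θ`.
  have hsum : ∑ j, q j = ∑ j, (q j / 2 * (1 - (y j : ℝ) * ⟪θ, x j + d j⟫) +
      q j / 2 * (1 - (y j : ℝ) * ⟪θ, x j + e j⟫)) := by
    have h := congrArg (fun v => ⟪θ, v⟫) hzero
    simp only [inner_sum, inner_zero_right] at h
    rw [← sub_zero (∑ j, q j), ← h, ← Finset.sum_sub_distrib]
    refine Finset.sum_congr rfl fun j _ => ?_
    simp only [inner_add_right, real_inner_smul_right]
    ring
  rw [hsum]
  refine Finset.sum_le_sum fun j _ => ?_
  have h₁ : 0 ≤ (1 / (J : ℝ) - q j) * max 0 (1 - (y j : ℝ) * ⟪θ, x j⟫) :=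
    mul_nonneg (sub_nonneg.2 (hq j).2) (le_max_left _ _)
  have h₂ : 0 ≤ q j / 2 := div_nonneg (hq j).1 zero_le_two
  have h₃ := mul_le_mul_of_nonneg_left (le_max_right 0 (1 - (y j : ℝ) * ⟪θ, x j + d j⟫)) h₂
  have h₄ := mul_le_mul_of_nonneg_left (le_max_right 0 (1 - (y j : ℝ) * ⟪θ, x j + e j⟫)) h₂
  linarith

/-- A perturbation within the transportation budget that balances the first moments is a Nash
strategy of nature. -/
theorem isNashStrategy_splitPerturbed (hJ : 0 < J) (N : Seminorm ℝ (Feature n))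
    (hN : ∀ v, N v = 0 → v = 0) (x : Fin J → Feature n) (y : Fin J → Label) (ε : ℝ≥0)
    {q : Fin J → ℝ} (hq : SolvesProgram x y N ε q) {d e : Fin J → Feature n}
    (hcost : ∑ j, q j / 2 * (N (d j) + N (e j)) ≤ ε)
    (hmean : ∑ j, (q j * (y j : ℝ) / 2) • (d j + e j) = direction x y q) :
    IsNashStrategy hingeLoss (ambiguitySet (labelCost N) (empirical x y) ε)
      (splitPerturbed x y q d e) := by
  obtain ⟨θ, L, hL, hθ, hval⟩ := exists_optimal_decision hJ N hN x y ε q hq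
  have hmem := splitPerturbed_mem_ambiguitySet hJ N x y ε hq.1.2 hcost
  have hupp : ∀ Q ∈ ambiguitySet (labelCost N) (empirical x y) ε,
      ∫⁻ z, hingeLoss θ z ∂Q ≤ ENNReal.ofReal (∑ j, q j) := fun Q hQ =>
    (lintegral_hingeLoss_le_of_mem_ambiguitySet N x y ε hL hθ hQ).trans
      (ENNReal.ofReal_le_ofReal hval)
  have hlow := le_lintegral_hingeLoss_splitPerturbed x y hq.1.2 hmean
  exact ⟨θ, hmem, fun Q hQ => (hupp Q hQ).trans (hlow θ), fun θ' => (hupp _ hmem).trans (hlow θ')⟩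

/-- The family `Q(α)` consists of perturbations that move both halves alike. -/
theorem perturbed_eq_splitPerturbed (x : Fin J → Feature n) (y : Fin J → Label)
    {q : Fin J → ℝ} (hq : ∀ j, 0 ≤ q j ∧ q j ≤ 1 / (J : ℝ)) (α : Fin J → ℝ) :
    perturbed x y q α =
      splitPerturbed x y q (fun j => (α j * (y j : ℝ) / q j) • direction x y q)
        (fun j => (α j * (y j : ℝ) / q j) • direction x y q) := by
  have hsplit : ∀ f : Fin J → Measure (Feature n × Label),
      ∑ j, f j = ∑ j ∈ indexZero q, f j + ∑ j ∈ indexPos q, f j := fun f => by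
    have : indexPos q = Finset.univ.filter fun j => ¬ q j = 0 := by
      ext j
      simp [indexPos, (hq j).1.lt_iff_ne']
    rw [this, indexZero, Finset.sum_filter_add_sum_filter_not]
  rw [perturbed, splitPerturbed, splitMeasure, hsplit, add_assoc, ← Finset.sum_add_distrib]
  congr 1
  · refine Finset.sum_congr rfl fun j hj => ?_
    have : q j = 0 := (Finset.mem_filter.1 hj).2
    simp [this]
  · refine Finset.sum_congr rfl fun j hj => ?_
    have : 0 < q j := (Finset.mem_filter.1 hj).2
    rw [add_assoc, ← add_smul, ← ENNReal.ofReal_add (by positivity) (by positivity), add_halves]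

theorem pos_of_weights_ne_zero {q α : Fin J → ℝ} (hq : ∀ j, 0 ≤ q j) (hα : α ∈ weights q)
    {j : Fin J} (hj : α j ≠ 0) : 0 < q j :=
  (hq j).lt_of_ne' fun h => hj (hα.2.2 j (by simp [indexZero, h]))

/-- The factors `q j` cancel and labels have modulus one, so the cost is `∑ j, α j * N ξ = N ξ ≤ ε`
and the balancing term is `∑ j, α j • ξ = ξ`. Where `q j = 0`, the weight `α j` vanishes as well. -/
theorem isNashStrategy_perturbed (hJ : 0 < J) (N : Seminorm ℝ (Feature n))
    (hN : ∀ v, N v = 0 → v = 0) (x : Fin J → Feature n) (y : Fin J → Label) (ε : ℝ≥0)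
    {q : Fin J → ℝ} (hq : SolvesProgram x y N ε q) {α : Fin J → ℝ} (hα : α ∈ weights q) :
    IsNashStrategy hingeLoss (ambiguitySet (labelCost N) (empirical x y) ε)
      (perturbed x y q α) := by
  have hpos : ∀ j, α j ≠ 0 → 0 < q j := fun j => pos_of_weights_ne_zero (fun j => (hq.1.2 j).1) hα
  have hNd : N (direction x y q) ≤ ε := by
    rw [direction, map_neg_eq_map]; exact hq.1.1
  rw [perturbed_eq_splitPerturbed x y hq.1.2]
  refine isNashStrategy_splitPerturbed hJ N hN x y ε hq ?_ ?_
  · refine le_trans (Eq.le (Eq.trans (b := ∑ j, α j * N (direction x y q)) ?_ ?_)) hNd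
    swap
    · rw [← Finset.sum_mul, hα.2.1, one_mul]
    refine Finset.sum_congr rfl fun j _ => ?_
    rcases eq_or_ne (α j) 0 with h | h
    · simp [h]
    · have hqj := hpos j h
      have : α j * (y j : ℝ) / q j = (y j : ℝ) * (α j / q j) := by ring
      rw [this, mul_smul, map_label_smul, map_smul_eq_mul,
        Real.norm_of_nonneg (div_nonneg (hα.1 j) hqj.le)]
      field_simp
      ring
  · refine Eq.trans (b := ∑ j, α j • direction x y q) ?_ ?_
    swap
    · rw [← Finset.sum_smul, hα.2.1, one_smul]
    refine Finset.sum_congr rfl fun j _ => ?_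
    rcases eq_or_ne (α j) 0 with h | h
    · simp [h]
    · have hqj := hpos j h
      rw [← add_smul, smul_smul]
      congr 1
      have := label_mul_self (y j)
      field_simp
      linear_combination 2 * this

end Equilibrium

/-! ### Continua detected by the second moment. -/

section Cardinality

variable {n J : ℕ}

/-- A set that maps onto the values of a nonconstant continuous function on an interval has at
least the cardinality of the continuum. -/
theorem continuum_le_mk_of_path {X : Type} (S : Set X) (F : X → ℝ) (γ : ℝ → X)
    (hγ : ∀ t ∈ Set.Icc (0 : ℝ) 1, γ t ∈ S) (hF : ContinuousOn (F ∘ γ) (Set.Icc 0 1))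
    {s t : ℝ} (hs : s ∈ Set.Icc (0 : ℝ) 1) (ht : t ∈ Set.Icc (0 : ℝ) 1)
    (hst : F (γ s) < F (γ t)) : 𝔠 ≤ #S := by
  have hsub : Set.Icc (F (γ s)) (F (γ t)) ⊆ F '' S := by
    intro r hr
    obtain ⟨u, hu, rfl⟩ := isPreconnected_Icc.intermediate_value hs ht hF hr
    exact ⟨γ u, hγ u hu, rfl⟩
  calc 𝔠 = #(Set.Icc (F (γ s)) (F (γ t))) := (Cardinal.mk_Icc_real hst).symm
    _ ≤ #(F '' S) := Cardinal.mk_le_mk_of_subset hsub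
    _ ≤ #S := Cardinal.mk_image_le

/-- The second moment of the features. -/
noncomputable def secondMoment (Q : Measure (Feature n × Label)) : ℝ :=
  (∫⁻ z, ENNReal.ofReal (‖z.1‖ ^ 2) ∂Q).toReal

theorem secondMoment_splitPerturbed (x : Fin J → Feature n) (y : Fin J → Label)
    {q : Fin J → ℝ} (hq : ∀ j, 0 ≤ q j ∧ q j ≤ 1 / (J : ℝ)) (d e : Fin J → Feature n) :
    secondMoment (splitPerturbed x y q d e) =
      ∑ j, ((1 / (J : ℝ) - q j) * ‖x j‖ ^ 2 + q j / 2 * ‖x j + d j‖ ^ 2 +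
        q j / 2 * ‖x j + e j‖ ^ 2) := by
  rw [secondMoment, lintegral_splitPerturbed_ofReal x y hq d e (f := fun z => ‖z.1‖ ^ 2)
    fun _ => sq_nonneg _, ENNReal.toReal_ofReal]
  refine Finset.sum_nonneg fun j _ => ?_
  have h₁ : 0 ≤ 1 / (J : ℝ) - q j := sub_nonneg.2 (hq j).2
  have h₂ : 0 ≤ q j := (hq j).1
  positivity

end Cardinality

/-! ### Paths of Nash strategies with varying second moment. -/

section Family

variable {n J : ℕ}

/-- Along an edge of the simplex the second moment is a quadratic polynomial with positive leading
coefficient, hence not constant. -/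
theorem continuum_le_mk_image_perturbed (x : Fin J → Feature n) (y : Fin J → Label)
    {q : Fin J → ℝ} (hq : ∀ j, 0 ≤ q j ∧ q j ≤ 1 / (J : ℝ)) (hcard : 2 ≤ (indexPos q).card)
    (hξ : direction x y q ≠ 0) : 𝔠 ≤ #(perturbed x y q '' weights q) := by
  classical
  obtain ⟨j₁, hj₁, j₂, hj₂, hne⟩ := Finset.one_lt_card.1 hcard
  have hq₁ : 0 < q j₁ := (Finset.mem_filter.1 hj₁).2
  have hq₂ : 0 < q j₂ := (Finset.mem_filter.1 hj₂).2
  set ξ := direction x y q with hξdef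
  set a : Fin J → ℝ := Pi.single j₁ 1 with ha
  set b : Fin J → ℝ := Pi.single j₂ 1 with hb
  let α : ℝ → Fin J → ℝ := fun t j => t * a j + (1 - t) * b j
  have hnonneg : ∀ i j : Fin J, 0 ≤ (Pi.single i 1 : Fin J → ℝ) j := fun i j =>
    (Pi.single_nonneg.2 zero_le_one : (0 : Fin J → ℝ) ≤ Pi.single i 1) j
  have hα : ∀ t ∈ Set.Icc (0 : ℝ) 1, α t ∈ weights q := by
    refine fun t ht => ⟨fun j => ?_, ?_, fun j hj => ?_⟩
    · exact add_nonneg (mul_nonneg ht.1 (hnonneg _ _))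
        (mul_nonneg (sub_nonneg.2 ht.2) (hnonneg _ _))
    · simp [α, a, b, Finset.sum_add_distrib, ← Finset.mul_sum]
    · have hj₀ : q j = 0 := (Finset.mem_filter.1 hj).2
      have h₁ : j ≠ j₁ := by rintro rfl; exact hq₁.ne' hj₀
      have h₂ : j ≠ j₂ := by rintro rfl; exact hq₂.ne' hj₀
      simp [α, a, b, h₁, h₂]
  let φ : ℝ → ℝ := secondMoment ∘ fun t => perturbed x y q (α t)
  have hφ : ∀ t, φ t = ∑ j, ((1 / (J : ℝ) - q j) * ‖x j‖ ^ 2 +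
      q j * ‖x j + (α t j * (y j : ℝ) / q j) • ξ‖ ^ 2) := fun t => by
    simp only [φ, Function.comp_apply]
    rw [perturbed_eq_splitPerturbed x y hq, secondMoment_splitPerturbed x y hq]
    exact Finset.sum_congr rfl fun j _ => by ring
  have hcont : Continuous φ := by
    rw [funext hφ]
    fun_prop
  have hconv : 0 < φ 0 + φ 1 - 2 * φ (1 / 2) := by
    have hterm : φ 0 + φ 1 - 2 * φ (1 / 2) =
        ∑ j, q j * ((a j - b j) * (y j : ℝ) / q j) ^ 2 * ‖ξ‖ ^ 2 / 2 := by
      rw [hφ, hφ, hφ, ← Finset.sum_add_distrib, Finset.mul_sum, ← Finset.sum_sub_distrib]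
      refine Finset.sum_congr rfl fun j _ => ?_
      simp only [norm_add_sq_real, norm_smul, real_inner_smul_right, mul_pow, Real.norm_eq_abs,
        sq_abs, α]
      ring
    rw [hterm]
    refine Finset.sum_pos' (fun j _ => ?_) ⟨j₁, Finset.mem_univ _, ?_⟩
    · have := (hq j).1
      positivity
    · have hy : ((y j₁ : ℝ)) ≠ 0 := left_ne_zero_of_mul_eq_one (label_mul_self (y j₁))
      have hab : a j₁ - b j₁ = 1 := by simp [a, b, hne]
      rw [hab]
      have := norm_pos_iff.2 hξ
      positivity
  have hpath : ∀ t ∈ Set.Icc (0 : ℝ) 1, perturbed x y q (α t) ∈ perturbed x y q '' weights q :=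
    fun t ht => ⟨α t, hα t ht, rfl⟩
  have hmid : (1 / 2 : ℝ) ∈ Set.Icc (0 : ℝ) 1 := by constructor <;> norm_num
  -- By strict convexity the midpoint value lies below at least one endpoint value.
  rcases lt_or_ge (φ (1 / 2)) (φ 0) with h | h
  · exact continuum_le_mk_of_path _ secondMoment _ hpath hcont.continuousOn hmid (by simp) h
  · exact continuum_le_mk_of_path _ secondMoment _ hpath hcont.continuousOn hmid
      (t := 1) (by simp) (show φ (1 / 2) < φ 1 by linarith)

theorem exists_pos_of_solvesProgram (hJ : 0 < J) (N : Seminorm ℝ (Feature n))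
    (x : Fin J → Feature n) (y : Fin J → Label) {ε : ℝ≥0} (hε : 0 < ε) {q : Fin J → ℝ}
    (hq : SolvesProgram x y N ε q) : ∃ j, 0 < q j := by
  by_contra! h
  have hJ' : (0 : ℝ) < J := by exact_mod_cast hJ
  have hε' : (0 : ℝ) < ε := by exact_mod_cast hε
  set S := N (∑ j, (y j : ℝ) • x j) with hS
  have hS₀ : 0 ≤ S := apply_nonneg N _
  -- The constant vector `δ` is feasible with positive sum; the `+ 1` keeps the denominator positive
  -- if `S = 0`.
  set δ : ℝ := min (1 / (J : ℝ)) (ε / (S + 1)) with hδ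
  have hδ₀ : 0 < δ := lt_min (by positivity) (by positivity)
  have := hq.2 (fun _ => δ) ⟨?_, fun j => ⟨hδ₀.le, min_le_left _ _⟩⟩
  · have h₁ : ∑ j, q j ≤ 0 := Finset.sum_nonpos fun j _ => h j
    simp only [Finset.sum_const, Finset.card_univ, Fintype.card_fin, nsmul_eq_mul] at this
    have := mul_pos hJ' hδ₀
    linarith
  · simp only [mul_smul, ← Finset.smul_sum]
    rw [map_smul_eq_mul, Real.norm_of_nonneg hδ₀.le, ← hS]
    have h₁ : δ * (S + 1) ≤ ε := by
      rw [← le_div_iff₀ (by positivity)]; exact min_le_right _ _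
    linarith

/-- All displacement is put on one sample `i`, whose two halves move by `p + s • w` and `p - s • w`.
The mean displacement `p` alone restores balance, and `s` is free. -/
theorem continuum_le_mk_isNashStrategy (hJ : 0 < J) (hn : 0 < n) (N : Seminorm ℝ (Feature n))
    (hN : ∀ v, N v = 0 → v = 0) (x : Fin J → Feature n) (y : Fin J → Label) {ε : ℝ≥0} (hε : 0 < ε)
    {q : Fin J → ℝ} (hq : SolvesProgram x y N ε q) :
    𝔠 ≤ #{Q : Measure (Feature n × Label) |
      IsNashStrategy hingeLoss (ambiguitySet (labelCost N) (empirical x y) ε) Q} := by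
  classical
  obtain ⟨i, hi⟩ := exists_pos_of_solvesProgram hJ N x y hε hq
  have hJ' : (1 : ℝ) ≤ J := by exact_mod_cast hJ
  have hi₁ : q i ≤ 1 := ((hq.1.2 i).2).trans (by rw [div_le_one (by linarith)]; exact hJ')
  set ξ := direction x y q with hξ
  have hNξ : N ξ ≤ ε := by
    rw [hξ, direction, map_neg_eq_map]; exact hq.1.1
  obtain ⟨p, hp⟩ : ∃ p : Feature n, p = (y i : ℝ) • ((q i)⁻¹ • ξ) := ⟨_, rfl⟩
  have hNp : q i * N p = N ξ := by
    rw [hp, map_label_smul, map_smul_eq_mul, Real.norm_of_nonneg (by positivity)]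
    field_simp
  -- If `p ≠ 0`, take `w = p`: stretching one half and shrinking the other leaves the cost at `N ξ`.
  -- If `p = 0`, the budget is unspent, and any direction of `N`-length `ε` is affordable because `q
  -- i ≤ 1`.
  obtain ⟨w, hw₀, hw⟩ : ∃ w : Feature n, w ≠ 0 ∧ ∀ s ∈ Set.Icc (0 : ℝ) 1,
      q i / 2 * (N (p + s • w) + N (p - s • w)) ≤ ε := by
    rcases eq_or_ne p 0 with h | h
    · have : Nonempty (Fin n) := ⟨⟨0, hn⟩⟩
      obtain ⟨v, hv⟩ := exists_ne (0 : Feature n)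
      have hNv : 0 < N v := lt_of_le_of_ne (apply_nonneg N v) fun h => hv (hN v h.symm)
      have hε' : (0 : ℝ) < ε := by exact_mod_cast hε
      refine ⟨((ε : ℝ) / N v) • v, smul_ne_zero (by positivity) hv, fun s hs => ?_⟩
      rw [h, zero_add, zero_sub, map_neg_eq_map, map_smul_eq_mul, map_smul_eq_mul,
        Real.norm_of_nonneg hs.1, Real.norm_of_nonneg (by positivity), div_mul_cancel₀ _ hNv.ne']
      have h₁ : s * ε ≤ 1 * ε := mul_le_mul_of_nonneg_right hs.2 hε'.le
      have h₂ : q i * (s * ε) ≤ 1 * (s * ε) :=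
        mul_le_mul_of_nonneg_right hi₁ (mul_nonneg hs.1 hε'.le)
      linarith
    · refine ⟨p, h, fun s hs => ?_⟩
      have h₁ : p + s • p = (1 + s) • p := by rw [add_smul, one_smul]
      have h₂ : p - s • p = (1 - s) • p := by rw [sub_smul, one_smul]
      rw [h₁, h₂, map_smul_eq_mul, map_smul_eq_mul, Real.norm_of_nonneg (by linarith [hs.1]),
        Real.norm_of_nonneg (by linarith [hs.2])]
      linarith
  set c : Fin J → ℝ := Pi.single i 1 with hc
  have hci : c i = 1 := by simp [c]
  have hcj : ∀ j, j ≠ i → c j = 0 := fun j hj => by simp [c, hj]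
  let γ : ℝ → Measure (Feature n × Label) := fun s =>
    splitPerturbed x y q (fun j => c j • (p + s • w)) (fun j => c j • (p - s • w))
  have hγ : ∀ s ∈ Set.Icc (0 : ℝ) 1, γ s ∈ {Q : Measure (Feature n × Label) |
      IsNashStrategy hingeLoss (ambiguitySet (labelCost N) (empirical x y) ε) Q} := by
    refine fun s hs => isNashStrategy_splitPerturbed hJ N hN x y ε hq ?_ ?_
    · rw [Finset.sum_eq_single i (fun j _ hj => by simp [hcj j hj]) (by simp)]
      simpa only [hci, one_smul] using hw s hs
    · rw [Finset.sum_eq_single i (fun j _ hj => by simp [hcj j hj]) (by simp)]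
      have h₁ : p + s • w + (p - s • w) = (2 : ℝ) • p := by rw [two_smul]; abel
      rw [hci, one_smul, one_smul, h₁, hp, smul_smul, smul_smul, smul_smul]
      have h₂ : q i * (y i : ℝ) / 2 * 2 * y i * (q i)⁻¹ = 1 := by
        have := label_mul_self (y i)
        field_simp
        linear_combination this
      rw [h₂, one_smul]
  -- The cross terms of the two halves cancel, so the spread adds exactly `q i * s ^ 2 * ‖w‖ ^ 2`.
  have hφ : ∀ s, secondMoment (γ s) = ∑ j, ((1 / (J : ℝ) - q j) * ‖x j‖ ^ 2 +
      q j * ‖x j + c j • p‖ ^ 2 + q j * (c j * s) ^ 2 * ‖w‖ ^ 2) := fun s => by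
    rw [secondMoment_splitPerturbed x y hq.1.2]
    refine Finset.sum_congr rfl fun j _ => ?_
    have h₁ : x j + c j • (p + s • w) = (x j + c j • p) + (c j * s) • w := by
      rw [smul_add, smul_smul, add_assoc]
    have h₂ : x j + c j • (p - s • w) = (x j + c j • p) - (c j * s) • w := by
      rw [smul_sub, smul_smul, add_sub_assoc]
    rw [h₁, h₂, norm_add_sq_real, norm_sub_sq_real, norm_smul, mul_pow, Real.norm_eq_abs, sq_abs]
    ring
  refine continuum_le_mk_of_path _ secondMoment γ hγ ?_ (s := 0) (t := 1) (by simp) (by simp) ?_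
  · have : secondMoment ∘ γ = fun s => secondMoment (γ s) := rfl
    rw [this, funext hφ]
    fun_prop
  · rw [hφ, hφ]
    refine Finset.sum_lt_sum (fun j _ => ?_) ⟨i, Finset.mem_univ i, ?_⟩
    · have := (hq.1.2 j).1
      have : 0 ≤ q j * (c j * 1) ^ 2 * ‖w‖ ^ 2 := by positivity
      simpa using this
    · have := norm_pos_iff.2 hw₀
      have : 0 < q i * (c i * 1) ^ 2 * ‖w‖ ^ 2 := by rw [hci]; positivity
      simpa using this

end Family

end DRSVM

theorem proposition4p1 {n J : ℕ} (hJ : 0 < J)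
    (N : Seminorm ℝ (DRSVM.Feature n)) (hN : ∀ v, N v = 0 → v = 0)
    (x : Fin J → DRSVM.Feature n) (y : Fin J → DRSVM.Label) (ε : ℝ≥0)
    (q : Fin J → ℝ) (hq : DRSVM.SolvesProgram x y N ε q) :
    -- every distribution of the family is a Nash strategy of nature
    (∀ α ∈ DRSVM.weights q,
      DRSVM.IsNashStrategy DRSVM.hingeLoss
        (DRSVM.ambiguitySet (DRSVM.labelCost N) (DRSVM.empirical x y) ε)
        (DRSVM.perturbed x y q α)) ∧
    -- the family itself is a continuum, unless it is degenerate
    (2 ≤ (DRSVM.indexPos q).card → DRSVM.direction x y q ≠ 0 →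
      𝔠 ≤ #(DRSVM.perturbed x y q '' DRSVM.weights q)) ∧
    -- there is a continuum of Nash strategies of nature, and hence of Nash equilibria
    (0 < n → 0 < ε →
      𝔠 ≤ #{Q : Measure (DRSVM.Feature n × DRSVM.Label) |
        DRSVM.IsNashStrategy DRSVM.hingeLoss
          (DRSVM.ambiguitySet (DRSVM.labelCost N) (DRSVM.empirical x y) ε) Q} ∧
      𝔠 ≤ #{E : DRSVM.Feature n × Measure (DRSVM.Feature n × DRSVM.Label) |
        DRSVM.IsNashEquilibrium DRSVM.hingeLoss
          (DRSVM.ambiguitySet (DRSVM.labelCost N) (DRSVM.empirical x y) ε) E.1 E.2}) := by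
  refine ⟨fun α hα => DRSVM.isNashStrategy_perturbed hJ N hN x y ε hq hα,
    DRSVM.continuum_le_mk_image_perturbed x y hq.1.2, fun hn hε => ?_⟩
  have h := DRSVM.continuum_le_mk_isNashStrategy hJ hn N hN x y hε hq
  refine ⟨h, h.trans ?_⟩
  -- The strategies are the image of the equilibria under the second projection.
  refine (Cardinal.mk_le_mk_of_subset ?_).trans (Cardinal.mk_image_le (f := Prod.snd))
  rintro Q ⟨θ, hθ⟩
  exact ⟨(θ, Q), hθ, rfl⟩
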